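/- **Model.** There are $n$ parties $\mathcal P=\{P_1,\dots,P_n\}$, connected by authenticated channels; time is discrete, and $\Delta\ge 1$ is a fixed publicly known delay bound. Let $V_{\mathrm{in}}$ be an at most countable set of inputs, $V_{\mathrm{out}}$ a nonempty set of outputs, and $0\le t_a\le t_s<n$ with $t_s>0$. *Input configurations and validity.* An input configuration $I$ assigns an input in $V_{\mathrm{in}}$ to each party of some set of at least $n-t_s$ parties (the honest parties); the other parties are corrupted. Let $\mathcal I$ be the set of all input configurations. A validity property is a map $\mathcal V:\mathcal I\to 2^{V_{\mathrm{out}}}$. It is *trivial* if $\bigcap_{I\in\mathcal I}\mathcal V(I)\neq\emptyset$. *Protocols.* A protocol may be randomized and may use an arbitrary trusted setup: there is a probability space $(\Omega,\mu)$, and for $\omega\in\Omega$ each party $P_i$ receives, before the start, a value $r_i(\omega)$ comprising its private coins, the public coins, and its share of the setup (for instance the public keys and its own secret key); the joint law of the $r_i$ is arbitrary. The code of a party is a deterministic state machine, started from its input and $r_i(\omega)$. At each tick it updates its state according to the messages just delivered to it, and it may send a message to each party and may output a value. *Adversaries.* A central static adversary knows the values $r_i(\omega)$ of the corrupted parties and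 sees all messages sent on the network. Depending on this, it chooses the messages sent by the corrupted parties and the delay of every message. In a synchronous network all delays are in $\{1,\dots,\Delta\}$; in an asynchronous network they are arbitrary positive integers. For each set $C$ of corrupted parties let $\mathcal A(C)$ be the class of admissible adversary strategies. In a setting without computational restrictions these are all strategies; with cryptographic setup they may be only those that forge no signatures or are computationally bounded. The only requirement on $\mathcal A$ is that corrupted parties are able to run the code of the protocol: $\mathcal A(C)$ contains every strategy in which the adversary runs finitely many groups of copies of the code of the parties in $C$, with their own values $r_i(\omega)$ and inputs of its choice, where copies in the same group exchange messages with each other and receive the messages addressed to them by the parties outside $C$, possibly with additional delay, and where every message sent by a corrupted party is one sent by one of its copies or is suppressed. Here all inputs, delays and forwarding choices are fixed in advance and do not change any more from some tick on. *Security.* A protocol is a $(t_s,t_a)$-secure network-agnostic Byzantine agreement protocol solving $\mathcal V$ (against $\mathcal A$) if, for every $I\in\mathcal I$ with set of corrupted parties $C$, and every strategy in $\mathcal A(C)$ that respects a synchronous network, or that respects an asynchronous network if $|C|\le t_a$, the following hold: (probabilistic termination) for every honest party, the probability that it has not output a value by time $t$ tends to $0$ as $t\to\infty$; (agreement) almost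 surely, any two values output by honest parties are equal; (validity) almost surely, every value output by an honest party is in $\mathcal V(I)$. **Theorem.** Let $\mathcal V$ be a validity property, with $t_s>0$, $t_a\le t_s<n$ and $n\le 2t_s+t_a$. If there is a $(t_s,t_a)$-secure network-agnostic Byzantine agreement protocol solving $\mathcal V$, then $\mathcal V$ is trivial. This holds for randomized protocols with an arbitrary trusted (cryptographic) setup, and for every class $\mathcal A$ of adversaries as above. -/

import Mathlib

open MeasureTheory Filter Topology

/-- An input configuration: the honest parties (those with `input i = some v`) together with their
inputs; the remaining parties, at most `ts` of them, are corrupted. -/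
structure InputConfig (n ts : ℕ) (Vin : Type*) where
  input : Fin n → Option Vin
  card_honest : n ≤ (Finset.univ.filter fun i => (input i).isSome).card + ts

/-- The set of corrupted parties of an input configuration. -/
def InputConfig.corrupted {n ts : ℕ} {Vin : Type*} (I : InputConfig n ts Vin) : Finset (Fin n) :=
  Finset.univ.filter fun i => (I.input i).isNone

/-- A validity property assigns to every input configuration the set of valid outputs. -/
abbrev ValidityProperty (n ts : ℕ) (Vin Vout : Type*) := InputConfig n ts Vin → Set Vout

/-- A validity property is trivial if some output is valid for all input configurations. -/
def ValidityProperty.IsTrivial {n ts : ℕ} {Vin Vout : Type*}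
    (𝒱 : ValidityProperty n ts Vin Vout) : Prop :=
  (⋂ I, 𝒱 I).Nonempty

/-- A (randomized) protocol for `n` parties, with an arbitrary trusted setup. Time is discrete.

A point `ω` of the probability space `(Ω, μ)` fixes all the randomness, including that of the
setup. Before the start, party `i` is handed `rand i ω`: its private coins, the public coins, and
its share of the setup (public keys, its own secret key, and so on); the joint law of these is
arbitrary. The code of a party is a state machine on an arbitrary state space. At every tick the
party sends at most one message (of an arbitrary type) to every party, and it may output a value;
at the next tick it updates its state according to the messages delivered at that tick. -/
structure Protocol (n : ℕ) (Vin Vout : Type*) where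
  Ω : Type*
  mΩ : MeasurableSpace Ω
  μ : Measure Ω
  prob : IsProbabilityMeasure μ
  Rand : Type*
  rand : Fin n → Ω → Rand
  Msg : Type*
  State : Type*
  /-- the initial state of a party, from its input and its randomness -/
  init : Fin n → Vin → Rand → State
  /-- `step i s m` is the next state of party `i`, where `m j` collects the messages from `j`
  delivered at that tick (channels are authenticated: the sender is known) -/
  step : Fin n → State → (Fin n → Multiset Msg) → State
  /-- `send i s j` is the message that party `i` sends to `j` when in state `s`, if any -/
  send : Fin n → State → Fin n → Option Msg
  /-- the value that party `i` outputs when in state `s`, if any -/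
  output : Fin n → State → Option Vout

attribute [instance] Protocol.mΩ Protocol.prob

namespace Protocol

variable {n : ℕ} {Vin Vout : Type*}

/-- What the adversary knows at some tick: the randomness and setup shares of the corrupted
parties, and the messages on the network so far (`heard s i j` is the message sent at tick `s` by
`i` to `j`), including those that the honest parties are sending at this very tick. -/
structure View (P : Protocol n Vin Vout) where
  secret : Fin n → Option P.Rand
  heard : ℕ → Fin n → Fin n → Option P.Msg

/-- A strategy of the central adversary: at tick `t`, as a function of its view, it chooses
the message that each corrupted `i` sends to each `j`, and the delay of the message that `i` sends
to `j` at tick `t` (for all `i`, `j`). -/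
structure Adversary (P : Protocol n Vin Vout) where
  send : P.View → ℕ → Fin n → Fin n → Option P.Msg
  delay : P.View → ℕ → Fin n → Fin n → ℕ

/-- The adversary respects an asynchronous network: every message is delivered eventually
(after a finite delay of at least one tick). -/
def Adversary.Asynchronous {P : Protocol n Vin Vout} (A : P.Adversary) : Prop :=
  ∀ v t i j, 1 ≤ A.delay v t i j

/-- The adversary respects a synchronous network: every message is delivered within `Δ`. -/
def Adversary.Synchronous {P : Protocol n Vin Vout} (A : P.Adversary) (Δ : ℕ) : Prop :=
  ∀ v t i j, 1 ≤ A.delay v t i j ∧ A.delay v t i j ≤ Δ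

/-- What happens at one tick of an execution: the states (`none` for the parties that do not run
the code of the protocol), the messages sent, and the delays of these messages. -/
structure Tick (P : Protocol n Vin Vout) where
  state : Fin n → Option P.State
  sent : Fin n → Fin n → Option P.Msg
  delay : Fin n → Fin n → ℕ

/-- An empty placeholder for ticks that have not happened yet. -/
def Tick.blank (P : Protocol n Vin Vout) : P.Tick where
  state _ := none
  sent _ _ := none
  delay _ _ := 0

/-- `P.inbox past t i j` collects the messages from `j` that are delivered to `i` at tick `t`. -/
def inbox (P : Protocol n Vin Vout) (past : ℕ → P.Tick) (t : ℕ) (i j : Fin n) :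
    Multiset P.Msg :=
  ∑ s ∈ Finset.range t,
    if s + (past s).delay j i = t then ((past s).sent j i).elim 0 fun m => {m} else 0

/-- The states at tick `t`, from the initial states and the earlier ticks. -/
def stateAt (P : Protocol n Vin Vout) (start : Fin n → Option P.State) (past : ℕ → P.Tick) :
    ℕ → Fin n → Option P.State
  | 0, i => start i
  | t + 1, i => ((past t).state i).map fun s => P.step i s (P.inbox past (t + 1) i)

/-- The view of the adversary at tick `t`, where `st` are the states at this tick. -/
def viewAt (P : Protocol n Vin Vout) (secret : Fin n → Option P.Rand) (past : ℕ → P.Tick)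
    (t : ℕ) (st : Fin n → Option P.State) : P.View where
  secret := secret
  heard s i j :=
    if s < t then (past s).sent i j
    else if s = t then (st i).bind fun x => P.send i x j
    else none

/-- Tick `t` of an execution, from the earlier ticks: parties with a state follow the protocol, and
the adversary, who knows `secret`, does everything else. -/
def nextTick (P : Protocol n Vin Vout) (start : Fin n → Option P.State)
    (secret : Fin n → Option P.Rand) (A : P.Adversary) (t : ℕ) (past : ℕ → P.Tick) : P.Tick where
  state := P.stateAt start past t
  sent i j :=
    match P.stateAt start past t i with
    | some s => P.send i s j
    | none => A.send (P.viewAt secret past t (P.stateAt start past t)) t i j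
  delay i j := A.delay (P.viewAt secret past t (P.stateAt start past t)) t i j

/-- The execution in which the parties `i` with `start i = some s` run the code of the protocol
from the state `s`, and the adversary `A`, who knows `secret`, controls everything else. -/
def run (P : Protocol n Vin Vout) (start : Fin n → Option P.State)
    (secret : Fin n → Option P.Rand) (A : P.Adversary) (t : ℕ) : P.Tick :=
  P.nextTick start secret A t fun s =>
    if _h : s < t then P.run start secret A s else Tick.blank P
termination_by t
decreasing_by exact _h

/-- The execution of `P` with input configuration `I`, adversary `A` and randomness `ω`. -/
def execution (P : Protocol n Vin Vout) {ts : ℕ} (I : InputConfig n ts Vin) (A : P.Adversary)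
    (ω : P.Ω) : ℕ → P.Tick :=
  P.run (fun i => (I.input i).map fun v => P.init i v (P.rand i ω))
    (fun i => if i ∈ I.corrupted then some (P.rand i ω) else none) A

/-- In the execution `e`, party `i` is honest and outputs `v` at tick `t`. -/
def OutputsAt (P : Protocol n Vin Vout) (e : ℕ → P.Tick) (i : Fin n) (v : Vout) (t : ℕ) : Prop :=
  ((e t).state i).bind (P.output i) = some v

/-- Probabilistic termination, agreement and validity, for the input configuration `I` and the
adversary `A`. -/
structure AchievesBA (P : Protocol n Vin Vout) {ts : ℕ} (𝒱 : ValidityProperty n ts Vin Vout)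
    (I : InputConfig n ts Vin) (A : P.Adversary) : Prop where
  /-- the probability that an honest party has not decided by time `t` tends to `0` -/
  termination : ∀ i ∉ I.corrupted,
    Tendsto (fun t => P.μ {ω | ∀ s ≤ t, ∀ v, ¬ P.OutputsAt (P.execution I A ω) i v s})
      atTop (𝓝 0)
  /-- any two outputs of honest parties are equal, almost surely -/
  agreement : ∀ᵐ ω ∂P.μ, ∀ i j v w s t,
    P.OutputsAt (P.execution I A ω) i v s → P.OutputsAt (P.execution I A ω) j w t → v = w
  /-- outputs of honest parties are valid, almost surely -/
  validity : ∀ᵐ ω ∂P.μ, ∀ i v t,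
    P.OutputsAt (P.execution I A ω) i v t → v ∈ 𝒱 I

/-- `P` is a `(ts, ta)`-secure Byzantine agreement protocol solving `𝒱` against the adversaries
in `𝒜`, where `𝒜 C` is the class of strategies available to an adversary that corrupts the
set `C`. -/
def IsSecureBA (P : Protocol n Vin Vout) (Δ ts ta : ℕ) (𝒱 : ValidityProperty n ts Vin Vout)
    (𝒜 : Finset (Fin n) → Set P.Adversary) : Prop :=
  ∀ (I : InputConfig n ts Vin), ∀ A ∈ 𝒜 I.corrupted,
    (A.Synchronous Δ ∨ (A.Asynchronous ∧ I.corrupted.card ≤ ta)) → P.AchievesBA 𝒱 I A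

end Protocol

/-- A fixed plan for an adversary that only runs copies of the code of the corrupted parties.
There are `copies` independent groups; each contains one copy of every corrupted party. -/
structure CopyPlan (n : ℕ) (Vin : Type*) where
  copies : ℕ
  /-- `input a i` is the input given to the copy of `i` in group `a` -/
  input : Fin copies → Fin n → Vin
  /-- `handover a t i j` is the delay after which a message sent by `i` to `j` at tick `t` is
  handed to the copy of `j` in group `a` -/
  handover : Fin copies → ℕ → Fin n → Fin n → ℕ
  /-- `speaker t i j` is the group whose copy of `i` determines what `i` sends to `j` at tick `t`;
  if it is `none`, nothing is sent -/
  speaker : ℕ → Fin n → Fin n → Option (Fin copies)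
  /-- the delays of the messages on the network -/
  delay : ℕ → Fin n → Fin n → ℕ

/-- The copies receive messages at least one tick after they are sent, and they receive a message
of a party outside `C` no earlier than the network delivers it. Moreover, the plan is a finite
object: from some tick `T` on, its tables no longer change. -/
structure CopyPlan.Valid {n : ℕ} {Vin : Type*} (p : CopyPlan n Vin) (C : Finset (Fin n)) :
    Prop where
  one_le : ∀ a t i j, 1 ≤ p.handover a t i j
  delay_le : ∀ a t i j, i ∉ C → p.delay t i j ≤ p.handover a t i j
  finite : ∃ T, ∀ t, T ≤ t → (∀ a, p.handover a t = p.handover a T) ∧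
    p.speaker t = p.speaker T ∧ p.delay t = p.delay T

/-- The execution within group `a`, as seen by the adversary with view `v`: each corrupted party
runs its code with its own randomness and setup share; copies in the same group send messages to
each other; what the parties outside `C` send is what is heard on the network. -/
def CopyPlan.group {n : ℕ} {Vin Vout : Type*} (p : CopyPlan n Vin) (P : Protocol n Vin Vout)
    (C : Finset (Fin n)) (a : Fin p.copies) (v : P.View) : ℕ → P.Tick :=
  P.run (fun i => if i ∈ C then (v.secret i).map (P.init i (p.input a i)) else none) v.secret
    { send := fun _ t i j => v.heard t i j
      delay := fun _ t i j => p.handover a t i j }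

/-- The strategy that carries out the plan `p` with the corrupted parties `C`. -/
def CopyPlan.adversary {n : ℕ} {Vin Vout : Type*} (p : CopyPlan n Vin) (P : Protocol n Vin Vout)
    (C : Finset (Fin n)) : P.Adversary where
  send v t i j := (p.speaker t i j).bind fun a => (p.group P C a v t).sent i j
  delay _ t i j := p.delay t i j

/-- The class `𝒜` of adversaries contains those whose corrupted parties only run copies of their
own code, with their own secrets, according to a fixed plan. This is the least that byzantine
parties can do in any setting: it holds for unrestricted adversaries, and also, with a
cryptographic setup, for adversaries that cannot forge the signatures of honest parties or whose
computational power only suffices for running the code of the protocol. -/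
def Protocol.CanRunCopies {n : ℕ} {Vin Vout : Type*} (P : Protocol n Vin Vout)
    (𝒜 : Finset (Fin n) → Set P.Adversary) : Prop :=
  ∀ (C : Finset (Fin n)) (p : CopyPlan n Vin), p.Valid C → p.adversary P C ∈ 𝒜 C

/-! Since `n ≤ 2 * ts + ta`, the parties split into nonempty sets `A`, `B` of size at most `ts` and
a rest `K` of size at most `ta`. In a lockstep run with inputs `J`, cut off `B` (or `A`) from some
tick on. With the silenced set corrupted this is a synchronous execution, so the remaining parties
decide almost surely. If `K` is corrupted and the network asynchronous, `K` can show `A` the run `J`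
with `B` cut at `s`, and `B` the run `J'` with `A` cut at `t`, while messages between `A` and `B`
are held back beyond the decisions (`execution_split`). By agreement, `a ∈ A` in the first run and
`b ∈ B` in the second decide alike (`ae_lockstepOutput_eq`). This works for all `J`, `J'` when both
cuts are at `0`, and for `J = J'` when the cuts differ by at most one tick. Cuts at `0` link all
inputs; moving the cuts one tick at a time then links all cut times. So, for almost every `ω`, `a`
has a single output `v` in all these runs (`ae_lockstepOutput_unique`). A cut later than the
decision is invisible, so `v` is also the output in every run without losses. Such a run is an
execution of every `I` consistent with its inputs, hence `v` is valid for all `I`. There are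
countably many `I`, so one `ω` serves them all. -/

namespace Protocol

variable {n : ℕ} {Vin Vout : Type*}

/-! ### Unfolding the recursion that defines an execution. -/

theorem inbox_congr (P : Protocol n Vin Vout) {past past' : ℕ → P.Tick} {t : ℕ}
    (h : ∀ s < t, past s = past' s) : P.inbox past t = P.inbox past' t := by
  funext i j
  refine Finset.sum_congr rfl fun s hs => ?_
  rw [h s (Finset.mem_range.1 hs)]

theorem stateAt_congr (P : Protocol n Vin Vout) (start : Fin n → Option P.State)
    {past past' : ℕ → P.Tick} {t : ℕ} (h : ∀ s < t, past s = past' s) :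
    P.stateAt start past t = P.stateAt start past' t := by
  funext i
  cases t with
  | zero => rfl
  | succ t => simp only [stateAt, h t (Nat.lt_succ_self t), inbox_congr P h]

theorem viewAt_congr (P : Protocol n Vin Vout) (secret : Fin n → Option P.Rand)
    {past past' : ℕ → P.Tick} {t : ℕ} (st : Fin n → Option P.State)
    (h : ∀ s < t, past s = past' s) :
    P.viewAt secret past t st = P.viewAt secret past' t st := by
  simp only [viewAt, View.mk.injEq, true_and]
  funext s i j
  by_cases hs : s < t
  · simp [hs, h s hs]
  · simp [hs]

theorem nextTick_congr (P : Protocol n Vin Vout) (start : Fin n → Option P.State)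
    (secret : Fin n → Option P.Rand) (A : P.Adversary) {past past' : ℕ → P.Tick} {t : ℕ}
    (h : ∀ s < t, past s = past' s) :
    P.nextTick start secret A t past = P.nextTick start secret A t past' := by
  simp only [nextTick, stateAt_congr P start h, viewAt_congr P secret _ h]

theorem run_eq_nextTick (P : Protocol n Vin Vout) (start : Fin n → Option P.State)
    (secret : Fin n → Option P.Rand) (A : P.Adversary) (t : ℕ) :
    P.run start secret A t = P.nextTick start secret A t (P.run start secret A) := by
  rw [run]
  exact P.nextTick_congr start secret A fun s hs => dif_pos hs

section Run

variable (P : Protocol n Vin Vout) (start : Fin n → Option P.State)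
  (secret : Fin n → Option P.Rand) (A : P.Adversary)

theorem run_state_zero (i : Fin n) : (P.run start secret A 0).state i = start i := by
  rw [run_eq_nextTick]; rfl

theorem run_state_succ (t : ℕ) (i : Fin n) :
    (P.run start secret A (t + 1)).state i = ((P.run start secret A t).state i).map fun s =>
      P.step i s (P.inbox (P.run start secret A) (t + 1) i) := by
  conv_lhs => rw [run_eq_nextTick]
  rfl

theorem run_state_eq_none {i : Fin n} (h : start i = none) (t : ℕ) :
    (P.run start secret A t).state i = none := by
  induction t with
  | zero => rw [run_state_zero, h]
  | succ t ih => rw [run_state_succ, ih]; rfl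

theorem run_sent_of_some {t : ℕ} {i : Fin n} {s : P.State}
    (h : (P.run start secret A t).state i = some s) (j : Fin n) :
    (P.run start secret A t).sent i j = P.send i s j := by
  rw [run_eq_nextTick] at h ⊢
  simp only [nextTick] at h ⊢
  rw [h]

theorem run_sent_of_none {t : ℕ} {i : Fin n}
    (h : (P.run start secret A t).state i = none) (j : Fin n) :
    (P.run start secret A t).sent i j = A.send
      (P.viewAt secret (P.run start secret A) t (P.run start secret A t).state) t i j := by
  have e : P.stateAt start (P.run start secret A) t = (P.run start secret A t).state := by
    rw [run_eq_nextTick P start secret A t]; rfl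
  rw [← e] at h ⊢
  rw [run_eq_nextTick]
  simp only [nextTick]
  rw [h]

theorem run_delay (t : ℕ) (i j : Fin n) :
    (P.run start secret A t).delay i j = A.delay
      (P.viewAt secret (P.run start secret A) t (P.run start secret A t).state) t i j := by
  have e : P.stateAt start (P.run start secret A) t = (P.run start secret A t).state := by
    rw [run_eq_nextTick P start secret A t]; rfl
  rw [← e]
  conv_lhs => rw [run_eq_nextTick]
  rfl

end Run

/-! ### Trajectories realised by a copy plan. -/

/-- If up to the horizon `N` every message is either delivered at the next tick or not at all, the
messages delivered at a tick are those sent at the previous one. -/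
theorem inbox_succ (P : Protocol n Vin Vout) {past : ℕ → P.Tick} {d : ℕ → Fin n → Fin n → ℕ}
    {N t : ℕ} (hd : ∀ s i j, (past s).delay i j = d s i j)
    (hN : ∀ s i j, d s i j = 1 ∨ N < s + d s i j) (ht : t < N) (i j : Fin n) :
    P.inbox past (t + 1) i j =
      if d t j i = 1 then ((past t).sent j i).elim 0 fun m => {m} else 0 := by
  rw [inbox, Finset.sum_range_succ, Finset.sum_eq_zero, zero_add]
  · simp [hd]
  -- Messages sent before tick `t` with delay `1` have already arrived; the others arrive after the
  -- horizon.
  · intro s hs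
    rw [Finset.mem_range] at hs
    rw [if_neg]
    rw [hd]
    rcases hN s j i with h | h <;> omega

/-- The copies in a group follow a trajectory `c` that obeys the code of the protocol, given that
the parties outside `C` follow `h`. -/
theorem group_state (P : Protocol n Vin Vout) {C : Finset (Fin n)} {p : CopyPlan n Vin}
    {ω : P.Ω} {N : ℕ} (a : Fin p.copies) {h c : ℕ → Fin n → P.State}
    (hand : ∀ s i j, p.handover a s i j = 1 ∨ N < s + p.handover a s i j)
    (c_zero : ∀ i ∈ C, c 0 i = P.init i (p.input a i) (P.rand i ω))
    (c_succ : ∀ t < N, ∀ i ∈ C, c (t + 1) i = P.step i (c t i) fun j =>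
      if p.handover a t j i = 1 then
        (P.send j (if j ∈ C then c t j else h t j) i).elim 0 fun m => {m} else 0)
    {v : P.View} {M : ℕ} (hM : M ≤ N) (secret : ∀ i ∈ C, v.secret i = some (P.rand i ω))
    (heard : ∀ s < M, ∀ i ∉ C, ∀ j, v.heard s i j = P.send i (h s i) j) :
    ∀ t ≤ M, ∀ i ∈ C, (p.group P C a v t).state i = some (c t i) := by
  intro t
  induction t with
  | zero =>
    intro _ i hi
    rw [CopyPlan.group, run_state_zero, if_pos hi, secret i hi, c_zero i hi]
    rfl
  | succ t ih =>
    intro ht i hi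
    have ih := ih (by omega)
    rw [CopyPlan.group, run_state_succ]
    have := ih i hi
    rw [CopyPlan.group] at this
    rw [this, c_succ t (by omega) i hi, Option.map_some]
    congr 2
    funext j
    rw [P.inbox_succ (d := p.handover a) (N := N) (fun s i j => run_delay _ _ _ _ s i j) hand
      (by omega)]
    congr 2
    by_cases hj : j ∈ C
    · rw [if_pos hj]
      exact run_sent_of_some P _ _ _ (ih j hj) i
    · rw [if_neg hj, ← heard t (by omega) j hj i]
      exact run_sent_of_none P _ _ _ (run_state_eq_none _ _ _ _ (if_neg hj) t) i

/-- Under the adversary that carries out the plan `p`, the honest parties follow `h`, provided that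
`h` and the trajectories `c a` of the copies obey the code of the protocol. -/
theorem execution_state (P : Protocol n Vin Vout) {ts : ℕ} (I : InputConfig n ts Vin)
    {p : CopyPlan n Vin} {ω : P.Ω} {N : ℕ} {h : ℕ → Fin n → P.State}
    {c : Fin p.copies → ℕ → Fin n → P.State}
    (hand : ∀ a s i j, p.handover a s i j = 1 ∨ N < s + p.handover a s i j)
    (delay : ∀ s i j, p.delay s i j = 1 ∨ N < s + p.delay s i j)
    (c_zero : ∀ a, ∀ i ∈ I.corrupted, c a 0 i = P.init i (p.input a i) (P.rand i ω))
    (c_succ : ∀ a, ∀ t < N, ∀ i ∈ I.corrupted, c a (t + 1) i = P.step i (c a t i) fun j =>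
      if p.handover a t j i = 1 then
        (P.send j (if j ∈ I.corrupted then c a t j else h t j) i).elim 0 fun m => {m} else 0)
    (h_zero : ∀ i ∉ I.corrupted, some (h 0 i) = (I.input i).map fun v => P.init i v (P.rand i ω))
    (h_succ : ∀ t < N, ∀ i ∉ I.corrupted, h (t + 1) i = P.step i (h t i) fun j =>
      if p.delay t j i = 1 then
        (if j ∈ I.corrupted then (p.speaker t j i).bind fun a => P.send j (c a t j) i
          else P.send j (h t j) i).elim 0 fun m => {m} else 0) :
    ∀ t ≤ N, ∀ i ∉ I.corrupted,
      (P.execution I (p.adversary P I.corrupted) ω t).state i = some (h t i) := by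
  intro t
  -- Strong induction: a message of a corrupted party is computed from everything heard from the
  -- honest parties so far.
  induction t using Nat.strong_induction_on with
  | _ t ih =>
  intro ht i hi
  cases t with
  | zero => rw [execution, run_state_zero, h_zero i hi]
  | succ t =>
    have ih : ∀ s ≤ t, ∀ i ∉ I.corrupted,
        (P.execution I (p.adversary P I.corrupted) ω s).state i = some (h s i) :=
      fun s hs i hi => ih s (by omega) (by omega) i hi
    have := ih t le_rfl i hi
    rw [execution] at this
    rw [execution, run_state_succ, this, h_succ t (by omega) i hi, Option.map_some]
    congr 2
    funext j
    rw [P.inbox_succ (d := p.delay) (N := N) (fun s i j => run_delay _ _ _ _ s i j) delay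
      (by omega)]
    congr 2
    by_cases hj : j ∈ I.corrupted
    · rw [if_pos hj]
      have hn : I.input j = none := by simpa [InputConfig.corrupted] using hj
      rw [run_sent_of_none P _ _ _ (run_state_eq_none _ _ _ _ (by simp [hn]) t) i]
      simp only [CopyPlan.adversary]
      congr 1
      funext a
      -- What a copy sends at tick `t` depends only on messages sent before `t`, hence `M := t`.
      refine run_sent_of_some P _ _ _ (P.group_state a (hand a) (c_zero a) (c_succ a)
        (M := t) (by omega) (fun i hi => if_pos hi) (fun s hs i hi j => ?_) t le_rfl j hj) i
      simp only [viewAt, if_pos hs]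
      exact run_sent_of_some P _ _ _ (ih s hs.le i hi) j
    · rw [if_neg hj]
      exact run_sent_of_some P _ _ _ (ih t le_rfl j hj) i

/-! ### Lockstep runs, input configurations and the two plans. -/

/-- The run in which every party follows the protocol with the inputs `J`, every message is
delivered at the next tick, except that the messages with `link t i j = false` are lost. -/
def lockstep (P : Protocol n Vin Vout) (J : Fin n → Vin) (link : ℕ → Fin n → Fin n → Bool)
    (ω : P.Ω) : ℕ → Fin n → P.State
  | 0, i => P.init i (J i) (P.rand i ω)
  | t + 1, i => P.step i (P.lockstep J link ω t i) fun j =>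
      if link t j i then (P.send j (P.lockstep J link ω t j) i).elim 0 fun m => {m} else 0

theorem lockstep_congr (P : Protocol n Vin Vout) (J : Fin n → Vin)
    {link link' : ℕ → Fin n → Fin n → Bool} (ω : P.Ω) {N : ℕ}
    (h : ∀ t < N, link t = link' t) : ∀ t ≤ N, P.lockstep J link ω t = P.lockstep J link' ω t := by
  intro t
  induction t with
  | zero => intro _; rfl
  | succ t ih =>
    intro ht
    funext i
    rw [lockstep, lockstep, ih (by omega), h t (by omega)]

/-- Party `i` outputs `v` at tick `t` of the lockstep run. -/
def LockstepOutput (P : Protocol n Vin Vout) (J : Fin n → Vin) (link : ℕ → Fin n → Fin n → Bool)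
    (ω : P.Ω) (i : Fin n) (v : Vout) (t : ℕ) : Prop :=
  P.output i (P.lockstep J link ω t i) = some v

end Protocol

/-- The input configuration with inputs `J` in which the parties in `C` are corrupted. -/
def InputConfig.ofCorrupted {n ts : ℕ} {Vin : Type*} (J : Fin n → Vin) (C : Finset (Fin n))
    (hC : C.card ≤ ts) : InputConfig n ts Vin where
  input i := if i ∈ C then none else some (J i)
  card_honest := by
    have : (Finset.univ.filter fun i => (if i ∈ C then none else some (J i)).isSome) = Cᶜ := by
      ext i; by_cases h : i ∈ C <;> simp [h]
    rw [this, Finset.card_compl, Fintype.card_fin]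
    omega

theorem InputConfig.corrupted_ofCorrupted {n ts : ℕ} {Vin : Type*} (J : Fin n → Vin)
    (C : Finset (Fin n)) (hC : C.card ≤ ts) : (ofCorrupted J C hC).corrupted = C := by
  ext i; by_cases h : i ∈ C <;> simp [corrupted, ofCorrupted, h]

theorem InputConfig.exists_notMem_corrupted {n ts : ℕ} {Vin : Type*} (I : InputConfig n ts Vin)
    (h : ts < n) : ∃ i, i ∉ I.corrupted := by
  have := I.card_honest
  obtain ⟨i, hi⟩ := Finset.card_pos.1 (by omega :
    0 < (Finset.univ.filter fun i => (I.input i).isSome).card)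
  exact ⟨i, by simpa [corrupted, Option.isSome_iff_ne_none] using hi⟩

instance {n ts : ℕ} {Vin : Type*} [Countable Vin] : Countable (InputConfig n ts Vin) :=
  Function.Injective.countable (f := InputConfig.input) fun I I' h => by
    cases I; cases I'; cases h; rfl

/-- Every corrupted party runs one copy of its code with input `J`, all delays are `1`, and the
messages with `link t i j = false` are suppressed. -/
def CopyPlan.lockstep {n : ℕ} {Vin : Type*} (J : Fin n → Vin)
    (link : ℕ → Fin n → Fin n → Bool) : CopyPlan n Vin where
  copies := 1
  input _ := J
  handover _ _ _ _ := 1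
  speaker t i j := if link t i j then some 0 else none
  delay _ _ _ := 1

theorem CopyPlan.lockstep_valid {n : ℕ} {Vin : Type*} (J : Fin n → Vin)
    {link : ℕ → Fin n → Fin n → Bool} (C : Finset (Fin n))
    (h : ∃ T, ∀ t, T ≤ t → link t = link T) : (CopyPlan.lockstep J link).Valid C where
  one_le _ _ _ _ := le_rfl
  delay_le _ _ _ _ _ := le_rfl
  finite := by
    obtain ⟨T, hT⟩ := h
    exact ⟨T, fun t ht => ⟨fun _ => rfl, by simp only [lockstep, hT t ht], rfl⟩⟩

/-- The parties in `A` receive no messages sent by `B` from tick `s` on, and vice versa from tick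
`t` on; such messages have delay `D`, all others have delay `1`. All other parties are corrupted and
run two copies: one talks to `A`, with inputs `J`, and ignores `B` from tick `s` on; the other one
talks to `B`, with inputs `J'`, and ignores `A` from tick `t` on. -/
def CopyPlan.split {n : ℕ} {Vin : Type*} (A B : Finset (Fin n)) (J J' : Fin n → Vin)
    (s t D : ℕ) : CopyPlan n Vin where
  copies := 2
  input a := if a = 0 then J else J'
  -- The last two alternatives never hold for a receiver outside `A ∪ B`; they serve only
  -- `delay_le`, which ranges over all receivers.
  handover a u i j :=
    if (if a = 0 then j ∉ B ∧ i ∈ B ∧ s ≤ u else j ∉ A ∧ i ∈ A ∧ t ≤ u) ∨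
      (j ∈ A ∧ i ∈ B ∧ s ≤ u) ∨ (j ∈ B ∧ i ∈ A ∧ t ≤ u) then D else 1
  speaker _ _ j := if j ∈ A then some 0 else some 1
  delay u i j := if (j ∈ A ∧ i ∈ B ∧ s ≤ u) ∨ (j ∈ B ∧ i ∈ A ∧ t ≤ u) then D else 1

theorem CopyPlan.split_valid {n : ℕ} {Vin : Type*} (A B C : Finset (Fin n)) (J J' : Fin n → Vin)
    {s t D : ℕ} (hD : 1 ≤ D) : (CopyPlan.split A B J J' s t D).Valid C where
  one_le a u i j := by dsimp only [split]; split_ifs <;> omega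
  delay_le a u i j _ := by
    simp only [split]
    by_cases h : (j ∈ A ∧ i ∈ B ∧ s ≤ u) ∨ (j ∈ B ∧ i ∈ A ∧ t ≤ u)
    · simp only [h, or_true, if_true, le_refl]
    · rw [if_neg h]; split_ifs <;> omega
  finite := by
    refine ⟨max s t, fun u hu => ?_⟩
    have h1 : s ≤ u := by omega
    have h2 : t ≤ u := by omega
    simp [split, h1, h2]

/-- The links when the messages from `B` to other parties are lost from tick `s` on. -/
def cutLink {n : ℕ} (B : Finset (Fin n)) (s : ℕ) : ℕ → Fin n → Fin n → Bool :=
  fun u i j => !decide (j ∉ B ∧ i ∈ B ∧ s ≤ u)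

/-! ### The executions that the two plans produce. -/

namespace Protocol

variable {n : ℕ} {Vin Vout : Type*}

/-- Honest parties and copies share one trajectory. Only messages from corrupted to honest parties
may be lost, which is what suppression can achieve. -/
theorem execution_lockstep (P : Protocol n Vin Vout) {ts : ℕ} (I : InputConfig n ts Vin)
    {J : Fin n → Vin} {link : ℕ → Fin n → Fin n → Bool}
    (hJ : ∀ i ∉ I.corrupted, I.input i = some (J i))
    (hlink : ∀ t i j, i ∉ I.corrupted ∨ j ∈ I.corrupted → link t i j = true)
    (ω : P.Ω) (t : ℕ) {i : Fin n} (hi : i ∉ I.corrupted) :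
    (P.execution I ((CopyPlan.lockstep J link).adversary P I.corrupted) ω t).state i =
      some (P.lockstep J link ω t i) := by
  refine P.execution_state I (N := t) (h := P.lockstep J link ω)
    (c := fun _ => P.lockstep J link ω) (fun _ _ _ _ => Or.inl rfl) (fun _ _ _ => Or.inl rfl)
    (fun _ _ _ => rfl) ?_ ?_ ?_ t le_rfl i hi
  · intro a u _ i hi
    rw [lockstep]
    congr 1
    funext j
    simp [CopyPlan.lockstep, hlink u j i (Or.inr hi)]
  · intro i hi
    rw [hJ i hi]; rfl
  · intro u _ i hi
    rw [lockstep]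
    congr 1
    funext j
    by_cases hj : j ∈ I.corrupted
    · by_cases hl : link u j i <;> simp [CopyPlan.lockstep, hj, hl]
    · simp [CopyPlan.lockstep, hj, hlink u j i (Or.inl hj)]

/-- Before its cut, each side still hears the other, which in reality follows the other run. Hence
`hs` and `ht`: up to the cuts, the two runs must agree on the senders. After the cuts, cross traffic
arrives beyond the horizon `u`, and each side hears only its own copies of the corrupted parties. -/
theorem execution_split (P : Protocol n Vin Vout) {ts : ℕ} (I : InputConfig n ts Vin)
    {A B : Finset (Fin n)} (hAB : Disjoint A B) (hI : I.corrupted = (A ∪ B)ᶜ)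
    {J J' : Fin n → Vin} (hA : ∀ i ∈ A, I.input i = some (J i))
    (hB : ∀ i ∈ B, I.input i = some (J' i)) {s t D : ℕ} {ω : P.Ω}
    (hs : ∀ u < s, ∀ i ∈ B,
      P.lockstep J' (cutLink A t) ω u i = P.lockstep J (cutLink B s) ω u i)
    (ht : ∀ u < t, ∀ i ∈ A,
      P.lockstep J (cutLink B s) ω u i = P.lockstep J' (cutLink A t) ω u i)
    {u : ℕ} (hu : u + 1 < D) {i : Fin n} (hi : i ∈ A ∪ B) :
    (P.execution I ((CopyPlan.split A B J J' s t D).adversary P I.corrupted) ω u).state i =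
      some (if i ∈ A then P.lockstep J (cutLink B s) ω u i
        else P.lockstep J' (cutLink A t) ω u i) := by
  have hBA : ∀ i ∈ B, i ∉ A := fun i hi hi' => Finset.disjoint_left.1 hAB hi' hi
  have hC : ∀ i, i ∈ I.corrupted ↔ i ∉ A ∧ i ∉ B := by simp [hI]
  have hD : D ≠ 1 := by omega
  refine P.execution_state I (N := u)
    (h := fun u i => if i ∈ A then P.lockstep J (cutLink B s) ω u i
      else P.lockstep J' (cutLink A t) ω u i)
    (c := fun a => if a = (0 : Fin 2) then P.lockstep J (cutLink B s) ω
      else P.lockstep J' (cutLink A t) ω) ?_ ?_ ?_ ?_ ?_ ?_ u le_rfl i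
      (by rw [hI, Finset.mem_compl, not_not]; exact hi)
  · intro a v i j
    simp only [CopyPlan.split]
    split_ifs <;> omega
  · intro v i j
    simp only [CopyPlan.split]
    split_ifs <;> omega
  · exact Fin.forall_fin_two.2 ⟨fun _ _ => rfl, fun _ _ => rfl⟩
  · refine Fin.forall_fin_two.2 ⟨fun v _ i hi => ?_, fun v _ i hi => ?_⟩
    · obtain ⟨hiA, hiB⟩ := (hC i).1 hi
      change P.lockstep J (cutLink B s) ω (v + 1) i = P.step i (P.lockstep J (cutLink B s) ω v i) fun j =>
        if (CopyPlan.split A B J J' s t D).handover (0 : Fin 2) v j i = 1 then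
          (P.send j (if j ∈ I.corrupted then P.lockstep J (cutLink B s) ω v j else
            if j ∈ A then P.lockstep J (cutLink B s) ω v j
            else P.lockstep J' (cutLink A t) ω v j) i).elim 0 fun m => {m} else 0
      rw [lockstep]
      congr 1
      funext j
      by_cases hjB : j ∈ B
      · by_cases hv : s ≤ v
        · simp [CopyPlan.split, cutLink, hiA, hiB, hjB, hv, hD]
        · simp [CopyPlan.split, cutLink, hiA, hiB, hjB, hv, hBA j hjB, hC,
            hs v (by omega) j hjB]
      · by_cases hjA : j ∈ A <;> simp [CopyPlan.split, cutLink, hiA, hiB, hjB, hjA, hC]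
    · obtain ⟨hiA, hiB⟩ := (hC i).1 hi
      change P.lockstep J' (cutLink A t) ω (v + 1) i = P.step i (P.lockstep J' (cutLink A t) ω v i) fun j =>
        if (CopyPlan.split A B J J' s t D).handover (1 : Fin 2) v j i = 1 then
          (P.send j (if j ∈ I.corrupted then P.lockstep J' (cutLink A t) ω v j else
            if j ∈ A then P.lockstep J (cutLink B s) ω v j
            else P.lockstep J' (cutLink A t) ω v j) i).elim 0 fun m => {m} else 0
      rw [lockstep]
      congr 1
      funext j
      by_cases hjA : j ∈ A
      · by_cases hv : t ≤ v
        · simp [CopyPlan.split, cutLink, hiA, hiB, hjA, hv, hD]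
        · simp [CopyPlan.split, cutLink, hiA, hiB, hjA, hv, hC,
            ht v (by omega) j hjA]
      · by_cases hjB : j ∈ B <;> simp [CopyPlan.split, cutLink, hiA, hiB, hjB, hjA, hC]
  · intro i hi
    by_cases hiA : i ∈ A
    · simp only [hiA, if_true, hA i hiA]; rfl
    · have hiB : i ∈ B := by by_contra hiB; exact hi ((hC i).2 ⟨hiA, hiB⟩)
      simp only [hiA, if_false, hB i hiB]; rfl
  · intro v _ i hi
    by_cases hiA : i ∈ A
    · have hiB : i ∉ B := fun h => hBA i h hiA
      simp only [if_pos hiA]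
      rw [lockstep]
      congr 1
      funext j
      by_cases hjB : j ∈ B
      · by_cases hv : s ≤ v
        · simp [CopyPlan.split, cutLink, hiA, hiB, hjB, hv, hD]
        · simp [CopyPlan.split, cutLink, hiA, hiB, hjB, hv, hBA j hjB, hC,
            hs v (by omega) j hjB]
      · by_cases hjA : j ∈ A <;> simp [CopyPlan.split, cutLink, hiA, hiB, hjB, hjA, hC]
    · have hiB : i ∈ B := by by_contra hiB; exact hi ((hC i).2 ⟨hiA, hiB⟩)
      simp only [if_neg hiA]
      rw [lockstep]
      congr 1
      funext j
      by_cases hjA : j ∈ A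
      · by_cases hv : t ≤ v
        · simp [CopyPlan.split, cutLink, hiA, hiB, hjA, hv, hD]
        · simp [CopyPlan.split, cutLink, hiA, hiB, hjA, hv, hC,
            ht v (by omega) j hjA]
      · by_cases hjB : j ∈ B <;> simp [CopyPlan.split, cutLink, hiA, hiB, hjB, hjA, hC]

/-! ### Almost sure consequences of security. -/

/-- An honest party outputs a value almost surely. -/
theorem AchievesBA.ae_exists_output {P : Protocol n Vin Vout} {ts : ℕ}
    {𝒱 : ValidityProperty n ts Vin Vout} {I : InputConfig n ts Vin} {A : P.Adversary}
    (h : P.AchievesBA 𝒱 I A) {i : Fin n} (hi : i ∉ I.corrupted) :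
    ∀ᵐ ω ∂P.μ, ∃ v t, P.OutputsAt (P.execution I A ω) i v t := by
  rw [ae_iff]
  refine le_antisymm (ge_of_tendsto' (h.termination i hi) fun t => measure_mono ?_) zero_le
  intro ω hω s _ v hv
  exact hω ⟨v, s, hv⟩

section Secure

variable {P : Protocol n Vin Vout} {Δ ts ta : ℕ} {𝒱 : ValidityProperty n ts Vin Vout}
  {𝒜 : Finset (Fin n) → Set P.Adversary}

theorem IsSecureBA.achievesBA_lockstep (hP : P.IsSecureBA Δ ts ta 𝒱 𝒜) (hΔ : 0 < Δ)
    (h𝒜 : P.CanRunCopies 𝒜) (I : InputConfig n ts Vin) (J : Fin n → Vin)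
    {link : ℕ → Fin n → Fin n → Bool} (hT : ∃ T, ∀ t, T ≤ t → link t = link T) :
    P.AchievesBA 𝒱 I ((CopyPlan.lockstep J link).adversary P I.corrupted) :=
  hP I _ (h𝒜 _ _ (CopyPlan.lockstep_valid J _ hT)) (Or.inl fun _ _ _ _ => ⟨le_rfl, hΔ⟩)

theorem cutLink_eventually (B : Finset (Fin n)) (s : ℕ) :
    ∃ T, ∀ t, T ≤ t → cutLink B s t = cutLink B s T :=
  ⟨s, fun t ht => by funext i j; simp [cutLink, ht]⟩

theorem IsSecureBA.ae_exists_lockstepOutput (hP : P.IsSecureBA Δ ts ta 𝒱 𝒜) (hΔ : 0 < Δ)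
    (h𝒜 : P.CanRunCopies 𝒜) (J : Fin n → Vin) {B : Finset (Fin n)} (hB : B.card ≤ ts) (s : ℕ)
    {i : Fin n} (hi : i ∉ B) :
    ∀ᵐ ω ∂P.μ, ∃ v t, P.LockstepOutput J (cutLink B s) ω i v t := by
  have hC := InputConfig.corrupted_ofCorrupted J B hB
  have hi' : i ∉ (InputConfig.ofCorrupted J B hB).corrupted := by rwa [hC]
  filter_upwards [(hP.achievesBA_lockstep hΔ h𝒜 (InputConfig.ofCorrupted J B hB) J
    (cutLink_eventually B s)).ae_exists_output hi'] with ω ⟨v, t, h⟩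
  refine ⟨v, t, ?_⟩
  rwa [OutputsAt, P.execution_lockstep _ (fun j hj => ?_) (fun u j k h => ?_) ω t hi'] at h
  · rw [hC] at hj; simp [InputConfig.ofCorrupted, hj]
  · rw [hC] at h; simp only [cutLink]; rcases h with h | h <;> simp [h]

/-- Agreement in the split execution. The alternatives in `hst` are the cases where the coherence
required by `execution_split` is automatic: with both cuts at `0` nothing is required, and with
equal inputs the runs coincide up to and including tick `min s t`, which covers every tick before
the later cut. -/
theorem IsSecureBA.ae_lockstepOutput_eq (hP : P.IsSecureBA Δ ts ta 𝒱 𝒜) (hta : ta ≤ ts)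
    (h𝒜 : P.CanRunCopies 𝒜) {A B : Finset (Fin n)} (hAB : Disjoint A B)
    (hK : (A ∪ B)ᶜ.card ≤ ta) {a b : Fin n} (ha : a ∈ A) (hb : b ∈ B) (J J' : Fin n → Vin)
    {s t : ℕ} (hst : (s = 0 ∧ t = 0) ∨ (J = J' ∧ s ≤ t + 1 ∧ t ≤ s + 1)) :
    ∀ᵐ ω ∂P.μ, ∀ v w x y, P.LockstepOutput J (cutLink B s) ω a v x →
      P.LockstepOutput J' (cutLink A t) ω b w y → v = w := by
  have hBA : ∀ i ∈ B, i ∉ A := fun i hi hi' => Finset.disjoint_left.1 hAB hi' hi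
  have coh : ∀ ω, ∀ u, u < s ∨ u < t →
      P.lockstep J (cutLink B s) ω u = P.lockstep J' (cutLink A t) ω u := by
    intro ω u hu
    rcases hst with h | ⟨rfl, h1, h2⟩
    · omega
    · refine P.lockstep_congr J ω (N := min s t) (fun v hv => ?_) u (by omega)
      have hv1 : ¬ s ≤ v := by omega
      have hv2 : ¬ t ≤ v := by omega
      funext i j
      simp [cutLink, hv1, hv2]
  set J₀ : Fin n → Vin := fun i => if i ∈ A then J i else J' i
  set I : InputConfig n ts Vin := InputConfig.ofCorrupted J₀ (A ∪ B)ᶜ (hK.trans hta)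
  have hC : I.corrupted = (A ∪ B)ᶜ := InputConfig.corrupted_ofCorrupted _ _ _
  -- The decision ticks depend on `ω` but the plan may not, so agreement is secured for all delays
  -- at once.
  have ag : ∀ᵐ ω ∂P.μ, ∀ D : ℕ, ∀ i j v w x y,
      P.OutputsAt (P.execution I
        ((CopyPlan.split A B J J' s t (D + 2)).adversary P I.corrupted) ω) i v x →
      P.OutputsAt (P.execution I
        ((CopyPlan.split A B J J' s t (D + 2)).adversary P I.corrupted) ω) j w y → v = w := by
    rw [ae_all_iff]
    intro D
    refine (hP I _ (h𝒜 _ _ (CopyPlan.split_valid A B _ J J' (by omega)))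
      (Or.inr ⟨fun _ u i j => ?_, by rwa [hC]⟩)).agreement
    simp only [CopyPlan.adversary, CopyPlan.split]
    split_ifs <;> omega
  filter_upwards [ag] with ω hω v w x y hv hw
  have key : ∀ u ≤ max x y, ∀ i ∈ A ∪ B, _ := fun u hu i hi =>
    P.execution_split I hAB hC (J := J) (J' := J')
      (fun i hi => by simp [I, J₀, InputConfig.ofCorrupted, hi])
      (fun i hi => by simp [I, J₀, InputConfig.ofCorrupted, hi, hBA i hi])
      (s := s) (t := t) (D := max x y + 2) (ω := ω)
      (fun u hu i _ => by rw [coh ω u (Or.inl hu)]) (fun u hu i _ => by rw [coh ω u (Or.inr hu)])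
      (u := u) (by omega) hi
  refine hω (max x y) a b v w x y ?_ ?_
  · rw [OutputsAt, key x (le_max_left _ _) a (Finset.mem_union_left _ ha), if_pos ha]
    exact hv
  · rw [OutputsAt, key y (le_max_right _ _) b (Finset.mem_union_right _ hb), if_neg (hBA b hb)]
    exact hw

/-- Almost surely, all the outputs of `a` in the runs that are cut at some tick coincide, for all
inputs. -/
theorem IsSecureBA.ae_lockstepOutput_unique [Countable Vin] (hP : P.IsSecureBA Δ ts ta 𝒱 𝒜)
    (hΔ : 0 < Δ) (hta : ta ≤ ts) (h𝒜 : P.CanRunCopies 𝒜) {A B : Finset (Fin n)}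
    (hAB : Disjoint A B) (hA : A.card ≤ ts) (hB : B.card ≤ ts)
    (hK : (A ∪ B)ᶜ.card ≤ ta) {a b : Fin n} (ha : a ∈ A) (hb : b ∈ B) (J₀ : Fin n → Vin) :
    ∀ᵐ ω ∂P.μ, ∃ v, ∀ J s w t, P.LockstepOutput J (cutLink B s) ω a w t → w = v := by
  have haB : a ∉ B := fun h => Finset.disjoint_left.1 hAB ha h
  have hbA : b ∉ A := fun h => Finset.disjoint_left.1 hAB h hb
  have e1 : ∀ᵐ ω ∂P.μ, ∀ (J : Fin n → Vin) (s : ℕ),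
      ∃ v t, P.LockstepOutput J (cutLink B s) ω a v t := by
    simp only [ae_all_iff]
    exact fun J s => hP.ae_exists_lockstepOutput hΔ h𝒜 J hB s haB
  have e2 : ∀ᵐ ω ∂P.μ, ∀ (J : Fin n → Vin) (s : ℕ),
      ∃ v t, P.LockstepOutput J (cutLink A s) ω b v t := by
    simp only [ae_all_iff]
    exact fun J s => hP.ae_exists_lockstepOutput hΔ h𝒜 J hA s hbA
  have e3 : ∀ᵐ ω ∂P.μ, ∀ J J' : Fin n → Vin, ∀ v w x y,
      P.LockstepOutput J (cutLink B 0) ω a v x →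
      P.LockstepOutput J' (cutLink A 0) ω b w y → v = w := by
    rw [ae_all_iff]; intro J; rw [ae_all_iff]; intro J'
    exact hP.ae_lockstepOutput_eq hta h𝒜 hAB hK ha hb J J' (Or.inl ⟨rfl, rfl⟩)
  have e4 : ∀ᵐ ω ∂P.μ, ∀ (J : Fin n → Vin) (s : ℕ), ∀ v w x y,
      P.LockstepOutput J (cutLink B s) ω a v x →
      P.LockstepOutput J (cutLink A (s + 1)) ω b w y → v = w := by
    rw [ae_all_iff]; intro J; rw [ae_all_iff]; intro s
    exact hP.ae_lockstepOutput_eq hta h𝒜 hAB hK ha hb J J (Or.inr ⟨rfl, by omega, by omega⟩)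
  have e5 : ∀ᵐ ω ∂P.μ, ∀ (J : Fin n → Vin) (s : ℕ), ∀ v w x y,
      P.LockstepOutput J (cutLink B s) ω a v x →
      P.LockstepOutput J (cutLink A s) ω b w y → v = w := by
    rw [ae_all_iff]; intro J; rw [ae_all_iff]; intro s
    exact hP.ae_lockstepOutput_eq hta h𝒜 hAB hK ha hb J J (Or.inr ⟨rfl, by omega, by omega⟩)
  filter_upwards [e1, e2, e3, e4, e5] with ω h1 h2 h3 h4 h5
  -- The reference value is the output of `b` with inputs `J₀` and `A` silent from the start.
  obtain ⟨v, x, hv⟩ := h2 J₀ 0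
  refine ⟨v, fun J s => ?_⟩
  induction s with
  | zero => exact fun w t hw => h3 J J₀ w v t x hw hv
  | succ s ih =>
    intro w t hw
    obtain ⟨w', y, hw'⟩ := h2 J (s + 1)
    obtain ⟨u, z, hu⟩ := h1 J s
    -- The output of `b` with `A` cut at `s + 1` links the outputs of `a` with `B` cut at `s + 1`
    -- and at `s`.
    rw [h5 J (s + 1) w w' t y hw hw', ← h4 J s u w' z y hu hw', ih u z hu]

/-- Almost surely, every output of `a` in the run with inputs `J` and no losses is valid for every
input configuration consistent with `J`. -/
theorem IsSecureBA.ae_exists_valid_output (hP : P.IsSecureBA Δ ts ta 𝒱 𝒜)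
    (hΔ : 0 < Δ) (h𝒜 : P.CanRunCopies 𝒜) (htn : ts < n) (I : InputConfig n ts Vin)
    {J : Fin n → Vin} (hJ : ∀ i ∉ I.corrupted, I.input i = some (J i)) (a : Fin n) :
    ∀ᵐ ω ∂P.μ, ∃ v ∈ 𝒱 I, ∃ t, P.LockstepOutput J (fun _ _ _ => true) ω a v t := by
  have hT : ∃ T, ∀ t, T ≤ t → (fun (_ : ℕ) (_ _ : Fin n) => true) t
    = (fun (_ : ℕ) (_ _ : Fin n) => true) T := ⟨0, fun _ _ => rfl⟩
  obtain ⟨i, hi⟩ := I.exists_notMem_corrupted htn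
  -- Party `a` may be corrupted in `I`. The same run with nobody corrupted makes it agree with the
  -- honest `i`, whose output is valid for `I`.
  set I₀ : InputConfig n ts Vin := InputConfig.ofCorrupted J ∅ (by simp)
  have hC : I₀.corrupted = ∅ := InputConfig.corrupted_ofCorrupted _ _ _
  have hC' : ∀ j, j ∉ I₀.corrupted := by simp [hC]
  have s1 := hP.achievesBA_lockstep hΔ h𝒜 I J hT
  have s2 := hP.achievesBA_lockstep hΔ h𝒜 I₀ J hT
  filter_upwards [s1.ae_exists_output hi, s1.validity, s2.ae_exists_output (hC' a), s2.agreement]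
    with ω ⟨v, t, hv⟩ val ⟨w, u, hw⟩ ag
  have e2 := fun t j => P.execution_lockstep I₀ (J := J) (link := fun _ _ _ => true)
    (fun i _ => by simp [I₀, InputConfig.ofCorrupted]) (fun _ _ _ _ => rfl) ω t (hC' j)
  have hv' := hv
  rw [OutputsAt, P.execution_lockstep I hJ (fun _ _ _ _ => rfl) ω t hi, ← e2 t i] at hv'
  have : v = w := ag i a v w t u hv' hw
  refine ⟨v, val i v t hv, u, ?_⟩
  rw [OutputsAt, e2] at hw
  rw [this]
  exact hw

end Secure

end Protocol

/-! ### The partition of the parties and the conclusion. -/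

theorem exists_disjoint_finsets_card_le {n ts ta : ℕ} (hts : 0 < ts) (htn : ts < n)
    (hn : n ≤ 2 * ts + ta) : ∃ A B : Finset (Fin n), Disjoint A B ∧ A.Nonempty ∧ B.Nonempty ∧
      A.card ≤ ts ∧ B.card ≤ ts ∧ (A ∪ B)ᶜ.card ≤ ta := by
  obtain ⟨A, -, hA⟩ := Finset.exists_subset_card_eq (s := (Finset.univ : Finset (Fin n)))
    (n := ts) (by simp; omega)
  have hAc : Aᶜ.card = n - ts := by rw [Finset.card_compl, Fintype.card_fin, hA]
  obtain ⟨B, hB, hBc⟩ := Finset.exists_subset_card_eq (s := Aᶜ) (n := min ts (n - ts))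
    (by omega)
  have hd : Disjoint A B := Finset.disjoint_left.2 fun i hi hi' =>
    Finset.mem_compl.1 (hB hi') hi
  refine ⟨A, B, hd, Finset.card_pos.1 (by omega), Finset.card_pos.1 (by omega), hA.le, by omega, ?_⟩
  rw [Finset.card_compl, Fintype.card_fin, Finset.card_union_of_disjoint hd]
  omega

theorem mainTheorem2 {Vin Vout : Type*} [Countable Vin] [Nonempty Vout]
    {n ts ta Δ : ℕ} (hts : 0 < ts) (hta : ta ≤ ts) (htn : ts < n) (hn : n ≤ 2 * ts + ta)
    (hΔ : 0 < Δ) (𝒱 : ValidityProperty n ts Vin Vout)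
    (P : Protocol n Vin Vout) (𝒜 : Finset (Fin n) → Set P.Adversary) (h𝒜 : P.CanRunCopies 𝒜)
    (hP : P.IsSecureBA Δ ts ta 𝒱 𝒜) :
    𝒱.IsTrivial := by
  -- Without inputs there are no configurations, as one needs an honest party; any output then
  -- works.
  rcases isEmpty_or_nonempty Vin with hV | ⟨⟨x₀⟩⟩
  · obtain ⟨v⟩ := ‹Nonempty Vout›
    refine ⟨v, Set.mem_iInter.2 fun I => ?_⟩
    obtain ⟨i, hi⟩ := I.exists_notMem_corrupted htn
    simp [InputConfig.corrupted, Option.ne_none_iff_exists'] at hi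
  obtain ⟨A, B, hAB, ⟨a, ha⟩, ⟨b, hb⟩, hA, hB, hK⟩ :=
    exists_disjoint_finsets_card_le hts htn hn
  have hJ : ∀ I : InputConfig n ts Vin, ∀ i ∉ I.corrupted,
      I.input i = some ((I.input i).getD x₀) := by
    intro I i hi
    obtain ⟨x, hx⟩ : ∃ x, I.input i = some x := by
      simpa [InputConfig.corrupted, Option.ne_none_iff_exists'] using hi
    simp [hx]
  have e1 := hP.ae_lockstepOutput_unique hΔ hta h𝒜 hAB hA hB hK ha hb fun _ => x₀
  have e2 : ∀ᵐ ω ∂P.μ, ∀ I : InputConfig n ts Vin, ∃ v ∈ 𝒱 I, ∃ t,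
      P.LockstepOutput (fun i => (I.input i).getD x₀) (fun _ _ _ => true) ω a v t :=
    ae_all_iff.2 fun I => hP.ae_exists_valid_output hΔ h𝒜 htn I (hJ I) a
  obtain ⟨ω, ⟨v, hv⟩, hω⟩ := (e1.and e2).exists
  refine ⟨v, Set.mem_iInter.2 fun I => ?_⟩
  obtain ⟨w, hw, t, ht⟩ := hω I
  -- Cutting `B` at the decision tick `t` itself leaves the states up to `t` unchanged.
  rw [← hv (fun i => (I.input i).getD x₀) t w t ?_]
  · exact hw
  rw [Protocol.LockstepOutput, P.lockstep_congr _ ω (N := t) (fun u hu => ?_) t le_rfl]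
  · exact ht
  · funext i j
    simp [cutLink, Nat.not_le.2 hu]
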